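/- Let $n\ge 3$ be a prime. For an odd prime power $q$, let $\mathbb F_q$ be the finite field with $q$ elements, let $s(n,q)$ be the number of elements of $SL_2(\mathbb F_q)$ of the form $x^n$ with $x\in SL_2(\mathbb F_q)$, and let $c(n,q)$ be the number of conjugacy classes of $SL_2(\mathbb F_q)$ which contain such an element. Then $|SL_2(\mathbb F_q)|=(q-1)q(q+1)$ and, for every odd prime power $q$: 1. if $n\nmid |SL_2(\mathbb F_q)|$, then $c(n,q)=q+4$ and $s(n,q)=q^3-q$; 2. if $n\mid q$, then $c(n,q)=q$ and $s(n,q)=(q-2)(q^2-1)$; 3. if $n\mid q-1$, then $c(n,q)=\frac{(n+1)(q-1)}{2n}+5$ and $s(n,q)=\frac{(n+1)(q^3-q)}{2n}$; 4. if $n\mid q+1$, then $c(n,q)=\frac{(n+1)(q-3)+4}{2n}+5$ and $s(n,q)=\frac{(n+1)(q^3-q)}{2n}$. Moreover, as $q\to\infty$ through the odd prime powers with $n\nmid q$ and $n\mid |SL_2(\mathbb F_q)|$ (that is, with $n\mid q^2-1$), the proportion of conjugacy classes of $SL_2(\mathbb F_q)$ which are $n$-th powers (that is, which contain an $n$-th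 power), namely $c(n,q)$ divided by the number of conjugacy classes of $SL_2(\mathbb F_q)$, and the proportion $s(n,q)/|SL_2(\mathbb F_q)|$ of elements which are $n$-th powers both tend to $\frac{n+1}{2n}$. -/

import Mathlib

universe u

/-- A conjugacy class `C` of `G` is an `n`-th power if it is the class of an `n`-th power
(equivalently, some, or every, element of `C` has an `n`-th root in `G`). -/
def IsPowerClass {G : Type u} [Group G] (n : ℕ) (C : ConjClasses G) : Prop :=
  ∃ x : G, ConjClasses.mk (x ^ n) = C

/-- The number `c(n, q)` of conjugacy classes of `SL₂(F)` that are `n`-th powers. -/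
noncomputable def numPowerClasses (n : ℕ) (F : Type u) [Field F] : ℕ :=
  Set.ncard {C : ConjClasses (Matrix.SpecialLinearGroup (Fin 2) F) | IsPowerClass n C}

/-- The number `s(n, q)` of elements of `SL₂(F)` that are `n`-th powers. -/
noncomputable def numPowers (n : ℕ) (F : Type u) [Field F] : ℕ :=
  Set.ncard {g : Matrix.SpecialLinearGroup (Fin 2) F |
    ∃ x : Matrix.SpecialLinearGroup (Fin 2) F, x ^ n = g}

/-! Away from trace `± 2`, a conjugacy class of `SL₂(𝔽_q)` with `q` odd is determined by its trace
`t = a + a⁻¹`. Frobenius fixes `t`, so it sends the eigenvalue `a` to `a` or `a⁻¹`, and `a` is a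
root of unity of order dividing `q - 1` (split torus) or `q + 1` (nonsplit torus). Since `x ^ n` has
eigenvalue `a ^ n`, the traces of `n`-th powers are the `b + b⁻¹` with `b ^ (N / gcd(N, n)) = 1`,
where `N = q ∓ 1`. Pairing `b` with `b⁻¹` counts these traces. A trace of split type is taken by `q
(q + 1)` elements, one of nonsplit type by `q (q - 1)`.

Trace `± 2` is treated separately. There are `2 q ^ 2` such elements in six classes: `1`, `-1`, and
two noncentral classes for each sign, told apart by a square class of `F`. If `n ∤ q`, dividing the
nilpotent part by `n` gives an `n`-th root of each of them; if `n ∣ q`, only `± 1` are `n`-th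
powers.

With `d = gcd(q - 1, n)` and `d' = gcd(q + 1, n)`, the case `n ∤ q` gives the proportion `1 / (2 d)
+ 1 / (2 d')` of elements. If `n ∣ q ^ 2 - 1`, exactly one of `d`, `d'` is `n` and the other is `1`,
whence `(n + 1) / (2 n)`. For classes this holds up to a bounded number of classes. The case `n = 1`
yields the order of the group and its class number. -/

open Matrix

/-! ### Conjugacy in `SL₂(F)` through the values of a binary quadratic form. -/

section Conjugacy

variable {F : Type u} [Field F]

/-- The binary quadratic form `v ↦ det (v, g v)`, for `v = (x, y)`. -/
def cyclicForm (g : SpecialLinearGroup (Fin 2) F) (x y : F) : F :=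
  g 1 0 * x ^ 2 + (g 1 1 - g 0 0) * x * y - g 0 1 * y ^ 2

/-- The matrix of trace `t` and determinant `1` sending `e₁` to `μ e₂`. -/
def twistedCompanion (μ : Fˣ) (t : F) : SpecialLinearGroup (Fin 2) F :=
  ⟨!![0, -(μ : F)⁻¹; (μ : F), t], by simp [det_fin_two]⟩

theorem SL2.det_eq (g : SpecialLinearGroup (Fin 2) F) : g 0 0 * g 1 1 - g 0 1 * g 1 0 = 1 := by
  rw [← det_fin_two]; exact g.det_coe

/-- The trace of an element of `SL₂`. -/
def SL2.tr (g : SpecialLinearGroup (Fin 2) F) : F := g 0 0 + g 1 1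

theorem SL2.mul_entry (g h : SpecialLinearGroup (Fin 2) F) (i j : Fin 2) :
    (g * h) i j = g i 0 * h 0 j + g i 1 * h 1 j := by
  change (g.1 * h.1) i j = _
  rw [Matrix.mul_apply, Fin.sum_univ_two]

theorem SL2.ext_entries {g h : SpecialLinearGroup (Fin 2) F} (h00 : g 0 0 = h 0 0)
    (h01 : g 0 1 = h 0 1) (h10 : g 1 0 = h 1 0) (h11 : g 1 1 = h 1 1) : g = h := by
  ext i j
  fin_cases i <;> fin_cases j <;> assumption

theorem SL2.tr_mul_comm (g h : SpecialLinearGroup (Fin 2) F) :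
    SL2.tr (g * h) = SL2.tr (h * g) := by
  simp only [SL2.tr, SL2.mul_entry]; ring

@[simp] theorem tr_twistedCompanion (μ : Fˣ) (t : F) : SL2.tr (twistedCompanion μ t) = t := by
  simp [twistedCompanion, SL2.tr]

theorem SL2.tr_eq_of_isConj {g h : SpecialLinearGroup (Fin 2) F} (H : IsConj g h) :
    SL2.tr g = SL2.tr h := by
  obtain ⟨c, hc⟩ := isConj_iff.1 H
  rw [← hc, SL2.tr_mul_comm, inv_mul_cancel_left]

/-- In the basis `v`, `μ⁻¹ g v` the matrix of `g` is the companion matrix, by Cayley–Hamilton. The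
base change has determinant `μ⁻¹ det (v, g v) = 1`, so it lies in `SL₂` and not merely in `GL₂`. -/
theorem isConj_twistedCompanion_of_cyclicForm_eq (g : SpecialLinearGroup (Fin 2) F) (x y : F)
    (μ : Fˣ) (h : cyclicForm g x y = μ) : IsConj g (twistedCompanion μ (SL2.tr g)) := by
  have hd := SL2.det_eq g
  have hμ := μ.ne_zero
  let P : SpecialLinearGroup (Fin 2) F :=
    ⟨!![x, (g 0 0 * x + g 0 1 * y) / μ; y, (g 1 0 * x + g 1 1 * y) / μ], by
      rw [det_fin_two_of]
      field_simp
      rw [← h, cyclicForm]; ring⟩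
  refine IsConj.symm (isConj_iff.2 ⟨P, ?_⟩)
  rw [mul_inv_eq_iff_eq_mul]
  apply SL2.ext_entries <;> rw [SL2.mul_entry, SL2.mul_entry] <;>
    simp [P, twistedCompanion, SL2.tr] <;> field_simp
  · linear_combination x * hd
  · linear_combination y * hd

/-- When the trace is `2 ε` the form degenerates to `ν (x + ε ν⁻¹ y) ^ 2`, so its nonzero values
form a single square class. Conjugation in `SL₂` preserves the set of values, which makes this
square class an invariant. -/
theorem exists_sq_mul_of_isConj_twistedCompanion {ε : F} (hε : ε ^ 2 = 1) {μ ν : Fˣ}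
    (h : IsConj (twistedCompanion μ (2 * ε)) (twistedCompanion ν (2 * ε))) :
    ∃ s : F, (μ : F) = ν * s ^ 2 := by
  obtain ⟨P, hP⟩ := isConj_iff.1 h
  rw [mul_inv_eq_iff_eq_mul] at hP
  have hd := SL2.det_eq P
  have hμ := μ.ne_zero
  have hν := ν.ne_zero
  have e00 := congrArg (fun g => g 0 0) hP
  have e10 := congrArg (fun g => g 1 0) hP
  simp only [SL2.mul_entry] at e00 e10
  simp [twistedCompanion] at e00 e10
  -- The linear form `x + ε ν⁻¹ y` evaluated at the first column of `P`, the image of `e₁`, where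
  -- the form of the first matrix takes the value `μ`.
  refine ⟨P 0 0 + ε * P 1 0 * (ν : F)⁻¹, ?_⟩
  field_simp at e00 ⊢
  linear_combination (-(μ * ν : F)) * hd + P 0 0 * ν * e10 + (-P 1 0 ) * e00 -
    (P 1 0) ^ 2 * hε

theorem isConj_twistedCompanion_mul_sq (μ s : Fˣ) (t : F) :
    IsConj (twistedCompanion μ t) (twistedCompanion (μ * s ^ 2) t) := by
  have := isConj_twistedCompanion_of_cyclicForm_eq (twistedCompanion μ t) s 0 (μ * s ^ 2)
    (by simp [cyclicForm, twistedCompanion])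
  simpa using this

theorem eq_one_or_neg_one_or_cyclicForm_ne_zero (g : SpecialLinearGroup (Fin 2) F) :
    g = 1 ∨ g = -1 ∨ ∃ x y, cyclicForm g x y ≠ 0 := by
  by_contra! H
  obtain ⟨h1, h2, h⟩ := H
  have h10 : g 1 0 = 0 := by simpa [cyclicForm] using h 1 0
  have h01 : g 0 1 = 0 := by simpa [cyclicForm] using h 0 1
  have hdiag : g 1 1 = g 0 0 := by
    have := h 1 1
    rw [cyclicForm, h10, h01] at this
    linear_combination this
  have hd := SL2.det_eq g
  rw [h10, hdiag] at hd
  have : g 0 0 = 1 ∨ g 0 0 = -1 := by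
    rw [← sq_eq_one_iff]; linear_combination hd
  rcases this with h0 | h0
  · apply h1
    ext i j
    fin_cases i <;> fin_cases j <;> simp [*]
  · apply h2
    ext i j
    fin_cases i <;> fin_cases j <;> simp [*]

theorem eq_one_or_neg_one_or_isConj_twistedCompanion (g : SpecialLinearGroup (Fin 2) F) :
    g = 1 ∨ g = -1 ∨ ∃ μ, IsConj g (twistedCompanion μ (SL2.tr g)) := by
  rcases eq_one_or_neg_one_or_cyclicForm_ne_zero g with h | h | ⟨x, y, h⟩
  · exact Or.inl h
  · exact Or.inr (Or.inl h)
  · exact Or.inr (Or.inr ⟨Units.mk0 _ h,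
      isConj_twistedCompanion_of_cyclicForm_eq g x y _ rfl⟩)

/-- The discriminant of the form is `tr(g) ^ 2 - 4`. A nondegenerate binary quadratic form over a
finite field of odd characteristic represents every element. -/
theorem exists_cyclicForm_eq [Finite F] (h2 : (2 : F) ≠ 0) (g : SpecialLinearGroup (Fin 2) F)
    (ht : SL2.tr g ^ 2 ≠ 4) (μ : F) : ∃ x y, cyclicForm g x y = μ := by
  classical
  have := Fintype.ofFinite F
  have hd := SL2.det_eq g
  rw [SL2.tr] at ht
  by_cases hc : g 1 0 = 0
  · have hne : g 1 1 - g 0 0 ≠ 0 := by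
      intro h
      apply ht
      rw [hc] at hd
      linear_combination 4 * hd + h * (g 1 1 - g 0 0)
    refine ⟨(μ + g 0 1) / (g 1 1 - g 0 0), 1, ?_⟩
    rw [cyclicForm, hc]
    field_simp
    ring
  · have hΔ : (g 1 1 - g 0 0) ^ 2 + 4 * g 0 1 * g 1 0 ≠ 0 := by
      intro h
      apply ht
      linear_combination 4 * hd + h
    have h4 : (4 : F) ≠ 0 := by
      have : (4 : F) = 2 * 2 := by norm_num
      rw [this]; exact mul_ne_zero h2 h2
    have hF : Fintype.card F % 2 = 1 :=
      FiniteField.odd_card_of_char_ne_two (by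
        intro hch
        have := ringChar.Nat.cast_ringChar (R := F)
        rw [hch] at this
        exact h2 (by exact_mod_cast this))
    -- Completing the square with `X = x + (g₁₁ - g₀₀) y / (2 g₁₀)` and `Y = y` diagonalises the
    -- form as `g₁₀ X ^ 2 - Δ / (4 g₁₀) Y ^ 2`, with `Δ` the discriminant.
    obtain ⟨X, Y, hXY⟩ := FiniteField.exists_root_sum_quadratic
      (f := Polynomial.C (g 1 0) * Polynomial.X ^ 2 + Polynomial.C 0 * Polynomial.X +
        Polynomial.C (-μ))
      (g := Polynomial.C (-((g 1 1 - g 0 0) ^ 2 + 4 * g 0 1 * g 1 0) / (4 * g 1 0)) *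
        Polynomial.X ^ 2 + Polynomial.C 0 * Polynomial.X + Polynomial.C 0)
      (Polynomial.degree_quadratic hc)
      (Polynomial.degree_quadratic (div_ne_zero (neg_ne_zero.2 hΔ) (mul_ne_zero h4 hc))) hF
    simp only [Polynomial.eval_add, Polynomial.eval_mul, Polynomial.eval_C, Polynomial.eval_pow,
      Polynomial.eval_X] at hXY
    refine ⟨X - (g 1 1 - g 0 0) * Y / (2 * g 1 0), Y, ?_⟩
    rw [cyclicForm]
    field_simp at hXY ⊢
    linear_combination hXY

theorem isConj_twistedCompanion_one [Finite F] (h2 : (2 : F) ≠ 0)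
    (g : SpecialLinearGroup (Fin 2) F) (ht : SL2.tr g ^ 2 ≠ 4) :
    IsConj g (twistedCompanion 1 (SL2.tr g)) := by
  obtain ⟨x, y, h⟩ := exists_cyclicForm_eq h2 g ht 1
  exact isConj_twistedCompanion_of_cyclicForm_eq g x y 1 (by simpa using h)

theorem isConj_of_tr_eq [Finite F] (h2 : (2 : F) ≠ 0)
    {g h : SpecialLinearGroup (Fin 2) F} (ht : SL2.tr g ^ 2 ≠ 4) (e : SL2.tr g = SL2.tr h) :
    IsConj g h := by
  have h1 := isConj_twistedCompanion_one h2 g ht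
  have h3 := isConj_twistedCompanion_one h2 h (e ▸ ht)
  rw [← e] at h3
  exact h1.trans h3.symm

/-- Replacing `v` by `s v` multiplies `μ` by `s ^ 2`, and the squares have index two in `Fˣ`; hence
only `μ = 1` and `μ = δ` matter. -/
theorem isConj_twistedCompanion_one_or [Finite F] (h2 : (2 : F) ≠ 0) {δ : Fˣ}
    (hδ : ¬ IsSquare (δ : F)) (μ : Fˣ) (t : F) :
    IsConj (twistedCompanion μ t) (twistedCompanion 1 t) ∨
      IsConj (twistedCompanion μ t) (twistedCompanion δ t) := by
  classical
  have := Fintype.ofFinite F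
  have hF : ringChar F ≠ 2 := by
    intro hch
    have := ringChar.Nat.cast_ringChar (R := F)
    rw [hch] at this
    exact h2 (by exact_mod_cast this)
  have key (μ : Fˣ) (h : IsSquare (μ : F)) : ∃ s : Fˣ, μ = s ^ 2 := by
    obtain ⟨s, hs⟩ := h
    have hs0 : s ≠ 0 := by
      rintro rfl
      simp at hs
    exact ⟨Units.mk0 s hs0, Units.ext (by simpa [sq] using hs)⟩
  by_cases hμ : IsSquare (μ : F)
  · left
    obtain ⟨s, rfl⟩ := key μ hμ
    simpa using (isConj_twistedCompanion_mul_sq 1 s t).symm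
  · right
    have : IsSquare ((μ * δ⁻¹ : Fˣ) : F) := by
      rw [← quadraticChar_one_iff_isSquare (Units.ne_zero _)]
      rw [Units.val_mul, Units.val_inv_eq_inv_val, map_mul]
      have e1 := quadraticChar_neg_one_iff_not_isSquare.2 hμ
      have e2 := quadraticChar_neg_one_iff_not_isSquare.2 hδ
      have e3 : quadraticChar F (δ : F) * quadraticChar F (δ : F)⁻¹ = 1 := by
        rw [← map_mul, mul_inv_cancel₀ δ.ne_zero, map_one]
      rw [e2] at e3
      rw [e1]; exact e3
    obtain ⟨s, hs⟩ := key _ this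
    have : μ = δ * s ^ 2 := by rw [← hs]; rw [mul_comm, inv_mul_cancel_right]
    rw [this]
    exact (isConj_twistedCompanion_mul_sq δ s t).symm

end Conjugacy

/-! ### The number of matrices with a given trace. -/

section TraceFibres

variable {F : Type u} [Field F]

/-- The split is on the lower left entry. If it is nonzero, it and the upper left entry are free and
the determinant fixes the rest. If it is zero, the diagonal consists of eigenvalues in `F` and the
upper right entry is free. So the size of a fibre depends only on the number of roots in `F` of the
characteristic polynomial. -/
theorem bijective_traceFibre (t : F) : Function.Bijective
    (Sum.elim
      (fun p : F × Fˣ => (⟨⟨!![p.1, (p.1 * (t - p.1) - 1) * (p.2 : F)⁻¹; (p.2 : F), t - p.1], by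
        simp [det_fin_two]⟩, by simp [SL2.tr]⟩ :
          {g : SpecialLinearGroup (Fin 2) F // SL2.tr g = t}))
      (fun p : {x : F // x * (t - x) = 1} × F => (⟨⟨!![p.1.1, p.2; 0, t - p.1.1], by
        simp [det_fin_two, p.1.2]⟩, by simp [SL2.tr]⟩ :
          {g : SpecialLinearGroup (Fin 2) F // SL2.tr g = t}))) := by
  constructor
  · have key {g h : {g : SpecialLinearGroup (Fin 2) F // SL2.tr g = t}} (e : g = h) (i j) :
        g.1 i j = h.1 i j := by rw [e]
    rintro (⟨x, z⟩ | ⟨⟨x, hx⟩, y⟩) (⟨x', z'⟩ | ⟨⟨x', hx'⟩, y'⟩) e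
    · have h0 := key e 0 0
      have h1 := key e 1 0
      simp at h0 h1
      rw [h0, Units.ext h1]
    · have h1 := key e 1 0
      simp at h1
    · have h1 := key e 1 0
      simp at h1
      exact absurd h1.symm z'.ne_zero
    · have h0 := key e 0 0
      have h1 := key e 0 1
      simp at h0 h1
      subst h0 h1
      rfl
  · rintro ⟨g, rfl⟩
    have hd := SL2.det_eq g
    by_cases hc : g 1 0 = 0
    · refine ⟨Sum.inr (⟨g 0 0, ?_⟩, g 0 1), ?_⟩
      · rw [SL2.tr]
        linear_combination hd + g 0 1 * hc
      · apply Subtype.ext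
        apply SL2.ext_entries <;> simp [SL2.tr, hc]
    · refine ⟨Sum.inl (g 0 0, Units.mk0 _ hc), ?_⟩
      apply Subtype.ext
      apply SL2.ext_entries <;> simp [SL2.tr]
      field_simp
      linear_combination hd

theorem card_traceFibre [Finite F] (t : F) :
    Nat.card {g : SpecialLinearGroup (Fin 2) F // SL2.tr g = t} =
      Nat.card F * (Nat.card F - 1) + Nat.card {x : F // x * (t - x) = 1} * Nat.card F := by
  rw [← Nat.card_congr (Equiv.ofBijective _ (bijective_traceFibre t)), Nat.card_sum, Nat.card_prod,
    Nat.card_prod, Nat.card_units]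

theorem ncard_setOf_tr_mem [Finite F] (U : Set F) (k : ℕ)
    (h : ∀ t ∈ U, Nat.card {g : SpecialLinearGroup (Fin 2) F // SL2.tr g = t} = k) :
    Set.ncard {g : SpecialLinearGroup (Fin 2) F | SL2.tr g ∈ U} = U.ncard * k := by
  classical
  have := Fintype.ofFinite F
  have hG : Fintype (SpecialLinearGroup (Fin 2) F) := Fintype.ofFinite _
  have e1 : {g : SpecialLinearGroup (Fin 2) F | SL2.tr g ∈ U} =
      (Finset.univ.filter fun g : SpecialLinearGroup (Fin 2) F => SL2.tr g ∈ U : Finset _) := by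
    ext; simp
  rw [e1, Set.ncard_coe_finset, Finset.card_eq_sum_card_fiberwise (t := U.toFinset) (f := SL2.tr)
    (by intro g hg; simpa using hg), Set.ncard_eq_toFinset_card', Finset.sum_const_nat]
  intro t ht
  rw [Set.mem_toFinset] at ht
  rw [← h t ht, Nat.card_eq_fintype_card, Fintype.card_subtype, Finset.filter_filter]
  congr 1
  ext g
  simp only [Finset.mem_filter, Finset.mem_univ, true_and, and_iff_right_iff_imp]
  rintro rfl
  exact ht

end TraceFibres

/-! ### Powers of a matrix: double eigenvalue `± 1`, and traces in general. -/

section Powers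

variable {F : Type u} [Field F]

theorem SL2.mul_self_entry (x : SpecialLinearGroup (Fin 2) F) (i j : Fin 2) :
    (x * x) i j = SL2.tr x * x i j - (1 : SpecialLinearGroup (Fin 2) F) i j := by
  have hd := SL2.det_eq x
  rw [SL2.mul_entry, SL2.tr]
  fin_cases i <;> fin_cases j <;> simp
  · linear_combination -hd
  · ring
  · ring
  · linear_combination -hd

/-- If `x` has the double eigenvalue `ε`, then `x ^ k = ε ^ k (1 + k (ε x - 1))`. -/
theorem SL2.pow_entry_of_tr {x : SpecialLinearGroup (Fin 2) F} {ε : F} (hε : ε ^ 2 = 1)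
    (hx : SL2.tr x = 2 * ε) (k : ℕ) (i j : Fin 2) :
    (x ^ k) i j = ε ^ k * ((1 - k) * (1 : SpecialLinearGroup (Fin 2) F) i j + k * ε * x i j) := by
  induction k generalizing i j with
  | zero => simp
  | succ k ih =>
    have h1 : x i j = (1 * x) i j := by rw [one_mul]
    have h2 := SL2.mul_self_entry x i j
    rw [SL2.mul_entry] at h1 h2
    rw [pow_succ, SL2.mul_entry, ih, ih]
    push_cast
    rw [hx] at h2
    linear_combination ε ^ k * (-(1 - k)) * h1 + ε ^ k * k * ε * h2 +
      ε ^ k * k * (2 * x i j) * hε -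
      ε ^ k * x i j * (k + 1) * hε

theorem SL2.exists_pow_eq_of_tr {n : ℕ} (hn : Odd n) (hnF : (n : F) ≠ 0) {ε : F} (hε : ε ^ 2 = 1)
    {g : SpecialLinearGroup (Fin 2) F} (hg : SL2.tr g = 2 * ε) : ∃ x, x ^ n = g := by
  have hd := SL2.det_eq g
  obtain ⟨m, rfl⟩ := hn
  rw [SL2.tr] at hg
  -- The root is `x = ε + (g - ε) / n`: since `g - ε` has square zero, `x ^ n = ε ^ n + n ε ^ (n -
  -- 1) (g - ε) / n`, and `n` odd gives `ε ^ n = ε` and `ε ^ (n - 1) = 1`.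
  let x : SpecialLinearGroup (Fin 2) F :=
    ⟨!![ε * (1 - ((2 * m + 1 : ℕ) : F)⁻¹) + g 0 0 * ((2 * m + 1 : ℕ) : F)⁻¹,
      g 0 1 * ((2 * m + 1 : ℕ) : F)⁻¹; g 1 0 * ((2 * m + 1 : ℕ) : F)⁻¹,
      ε * (1 - ((2 * m + 1 : ℕ) : F)⁻¹) + g 1 1 * ((2 * m + 1 : ℕ) : F)⁻¹], by
      generalize ((2 * m + 1 : ℕ) : F)⁻¹ = c
      rw [det_fin_two_of]
      linear_combination (1 - c ^ 2) * hε + c ^ 2 * hd + ε * (1 - c) * c * hg⟩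
  have hx : SL2.tr x = 2 * ε := by
    simp only [SL2.tr, x]
    simp
    generalize (2 * (m : F) + 1)⁻¹ = c
    linear_combination c * hg
  have hp : ε ^ (2 * m + 1) = ε := by rw [pow_succ, pow_mul, hε, one_pow, one_mul]
  refine ⟨x, ?_⟩
  apply SL2.ext_entries <;> rw [SL2.pow_entry_of_tr hε hx, hp] <;> simp [x] <;>
    push_cast at hnF <;> field_simp
  · linear_combination (g 0 0 + 2 * m * ε) * hε
  · linear_combination g 0 1 * hε
  · linear_combination g 1 0 * hε
  · linear_combination (g 1 1 + 2 * m * ε) * hε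

theorem SL2.pow_eq_of_tr {n : ℕ} (hnF : (n : F) = 0) {ε : F} (hε : ε ^ 2 = 1)
    {x : SpecialLinearGroup (Fin 2) F} (hx : SL2.tr x = 2 * ε) : x ^ n = 1 ∨ x ^ n = -1 := by
  have h : (ε ^ n) = 1 ∨ ε ^ n = -1 := by
    rw [← sq_eq_one_iff, ← pow_mul, mul_comm, pow_mul, hε, one_pow]
  rcases h with h | h
  · left
    apply SL2.ext_entries <;> rw [SL2.pow_entry_of_tr hε hx, h, hnF] <;> simp
  · right
    apply SL2.ext_entries <;> rw [SL2.pow_entry_of_tr hε hx, h, hnF] <;> simp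

/-- Both sides satisfy the recurrence `u (n + 2) = tr(x) u (n + 1) - u n`. No diagonalisation
enters, so a double eigenvalue is allowed. -/
theorem SL2.tr_pow {K : Type*} [Field K] [Algebra F K] (x : SpecialLinearGroup (Fin 2) F) {a : K}
    (ha : a ≠ 0) (hx : algebraMap F K (SL2.tr x) = a + a⁻¹) (n : ℕ) :
    algebraMap F K (SL2.tr (x ^ n)) = a ^ n + (a ^ n)⁻¹ := by
  induction n using Nat.twoStepInduction with
  | zero => simp [SL2.tr]
  | one => simpa using hx
  | more n h1 h2 =>
    have : SL2.tr (x ^ (n + 2)) = SL2.tr x * SL2.tr (x ^ (n + 1)) - SL2.tr (x ^ n) := by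
      have e : x ^ (n + 2) = x ^ n * (x * x) := by rw [pow_add, sq]
      have e' : x ^ (n + 1) = x ^ n * x := pow_succ _ _
      rw [e, e']
      have hd := SL2.det_eq x
      simp only [SL2.tr, SL2.mul_entry]
      linear_combination (-((x ^ n) 0 0 + (x ^ n) 1 1)) * hd
    rw [this, map_sub, map_mul, h1, h2, hx]
    field_simp
    ring

end Powers

/-- In a cyclic group of order `N` the `n`-th powers are the subgroup of order `N / gcd(N, n)`. -/
theorem exists_pow_eq_of_pow_div_gcd_eq_one {K : Type*} [Field K] {N n : ℕ} (hN : 0 < N) {ζ : K}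
    (hζ : IsPrimitiveRoot ζ N) {b : K} (hb : b ^ (N / N.gcd n) = 1) :
    ∃ a, a ^ N = 1 ∧ a ^ n = b := by
  have hd : 0 < N.gcd n := Nat.gcd_pos_of_pos_left _ hN
  have hp : IsPrimitiveRoot (ζ ^ N.gcd n) (N / N.gcd n) :=
    hζ.pow hN (Nat.mul_div_cancel' (Nat.gcd_dvd_left N n)).symm
  have : NeZero (N / N.gcd n) :=
    ⟨(Nat.div_pos (Nat.le_of_dvd hN (Nat.gcd_dvd_left N n)) hd).ne'⟩
  obtain ⟨k, -, rfl⟩ := hp.eq_pow_of_pow_eq_one hb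
  have h0 : ζ ≠ 0 := hζ.ne_zero hN.ne'
  refine ⟨ζ ^ (N.gcdB n * k), ?_, ?_⟩
  · rw [← zpow_natCast, ← _root_.zpow_mul, mul_comm, _root_.zpow_mul, zpow_natCast, hζ.pow_eq_one, _root_.one_zpow]
  -- Bézout: `gcd(N, n)` is congruent to `n * gcdB` modulo `N`. The exponents are integers because
  -- the Bézout coefficient may be negative.
  · have hg : ζ ^ N.gcd n = ζ ^ (n * N.gcdB n) := by
      rw [← zpow_natCast, Nat.gcd_eq_gcd_ab, zpow_add₀ h0, _root_.zpow_mul, zpow_natCast,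
        hζ.pow_eq_one, _root_.one_zpow, one_mul]
    rw [hg, ← zpow_natCast, ← zpow_natCast, ← _root_.zpow_mul, ← _root_.zpow_mul]
    congr 1
    ring

/-! ### Frobenius and the descent of eigenvalues and traces to `F`. -/

section FieldOfDefinition

variable {F : Type u} [Field F] [Finite F] {K : Type*} [Field K] [Algebra F K]

theorem algebraMap_pow_card (x : F) : algebraMap F K x ^ Nat.card F = algebraMap F K x := by
  have := Fintype.ofFinite F
  rw [← map_pow, Nat.card_eq_fintype_card, FiniteField.pow_card]

theorem mem_range_algebraMap_of_pow_card {z : K} (hz : z ^ Nat.card F = z) :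
    ∃ x : F, algebraMap F K x = z := by
  classical
  have := Fintype.ofFinite F
  have h1 : 1 < Nat.card F := Finite.one_lt_card
  have hne : (Polynomial.X ^ Nat.card F - Polynomial.X : Polynomial K) ≠ 0 :=
    FiniteField.X_pow_card_sub_X_ne_zero K h1
  have hroot (w : K) : w ∈ (Polynomial.X ^ Nat.card F - Polynomial.X : Polynomial K).roots.toFinset
      ↔ w ^ Nat.card F = w := by
    rw [Multiset.mem_toFinset, Polynomial.mem_roots hne]
    simp [Polynomial.IsRoot, sub_eq_zero]
  have hsub : Finset.univ.image (algebraMap F K) ⊆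
      (Polynomial.X ^ Nat.card F - Polynomial.X : Polynomial K).roots.toFinset := by
    intro w hw
    obtain ⟨x, -, rfl⟩ := Finset.mem_image.1 hw
    exact (hroot _).2 (algebraMap_pow_card x)
  -- The image of `F` already supplies `q` roots of `X ^ q - X`, as many as its degree permits.
  have heq := Finset.eq_of_subset_of_card_le hsub (by
    rw [Finset.card_image_of_injective _ (algebraMap F K).injective, Finset.card_univ,
      ← Nat.card_eq_fintype_card]
    refine (Multiset.toFinset_card_le _).trans ((Polynomial.card_roots' _).trans ?_)
    rw [FiniteField.X_pow_card_sub_X_natDegree_eq K h1])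
  have := (hroot z).2 hz
  rw [← heq] at this
  obtain ⟨x, -, hx⟩ := Finset.mem_image.1 this
  exact ⟨x, hx⟩

theorem natCast_card_eq_zero : (Nat.card F : K) = 0 := by
  have := Fintype.ofFinite F
  rw [Nat.card_eq_fintype_card, ← map_natCast (algebraMap F K), FiniteField.cast_card_eq_zero,
    map_zero]

theorem add_inv_pow_card {a : K} : (a + a⁻¹) ^ Nat.card F = a ^ Nat.card F + (a ^ Nat.card F)⁻¹ := by
  have := Fintype.ofFinite F
  obtain ⟨p, hp⟩ := CharP.exists F
  have := charP_of_injective_algebraMap (algebraMap F K).injective p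
  obtain ⟨k, hp', hk⟩ := FiniteField.card F p
  have := Fact.mk hp'
  rw [Nat.card_eq_fintype_card, hk, add_pow_char_pow, inv_pow]

theorem add_inv_eq_iff {a b : K} (ha : a ≠ 0) (hb : b ≠ 0) :
    a + a⁻¹ = b + b⁻¹ ↔ a = b ∨ a = b⁻¹ := by
  constructor
  · intro h
    have : (a - b) * (a - b⁻¹) = 0 := by
      field_simp at h ⊢
      linear_combination h
    rcases mul_eq_zero.1 this with h | h
    · exact Or.inl (sub_eq_zero.1 h)
    · exact Or.inr (sub_eq_zero.1 h)
  · rintro (rfl | rfl)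
    · rfl
    · rw [inv_inv, add_comm]

/-- Frobenius fixes `t = a + a⁻¹`, hence permutes `{a, a⁻¹}`: either `a ^ q = a` or `a ^ q = a⁻¹`.
-/
theorem pow_card_sub_one_or_add_one {a : K} (ha : a ≠ 0) {t : F}
    (h : algebraMap F K t = a + a⁻¹) :
    a ^ (Nat.card F - 1) = 1 ∨ a ^ (Nat.card F + 1) = 1 := by
  have h1 : 0 < Nat.card F := Nat.card_pos
  have e := algebraMap_pow_card (K := K) t
  rw [h, add_inv_pow_card (F := F), add_inv_eq_iff (pow_ne_zero _ ha) ha] at e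
  rcases e with e | e
  · left
    apply mul_left_cancel₀ ha
    rw [← pow_succ', Nat.sub_add_cancel h1, e, mul_one]
  · right
    rw [pow_succ, e, inv_mul_cancel₀ ha]

theorem exists_algebraMap_eq_add_inv {m : ℕ}
    (hm : m ∣ Nat.card F - 1 ∨ m ∣ Nat.card F + 1) {a : K} (h0 : a ≠ 0) (ha : a ^ m = 1) :
    ∃ t : F, algebraMap F K t = a + a⁻¹ := by
  have h1 : 0 < Nat.card F := Nat.card_pos
  apply mem_range_algebraMap_of_pow_card
  rw [add_inv_pow_card, add_inv_eq_iff (pow_ne_zero _ h0) h0]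
  rcases hm with ⟨k, hk⟩ | ⟨k, hk⟩
  · left
    have : Nat.card F = m * k + 1 := by omega
    rw [this, pow_succ, pow_mul, ha, one_pow, one_mul]
  · right
    apply eq_inv_of_mul_eq_one_left
    rw [← pow_succ, hk, pow_mul, ha, one_pow]

end FieldOfDefinition

/-! ### Traces coming from roots of unity: their number and the size of their fibres. -/

section TorusTraces

variable (F : Type u) [Field F]

/-- The elements `a + a⁻¹` of `F`, for `a` an `m`-th root of unity other than `± 1` in the
algebraic closure of `F`. -/
def torusTraces (m : ℕ) : Set F :=
  {t | ∃ a : AlgebraicClosure F, a ^ m = 1 ∧ a ^ 2 ≠ 1 ∧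
    algebraMap F (AlgebraicClosure F) t = a + a⁻¹}

variable {F}

theorem sq_eq_one_of_add_inv {K : Type*} [Field K] {a : K} (ha : a ≠ 0)
    (h : (a + a⁻¹) ^ 2 = 4) : a ^ 2 = 1 := by
  have : (a ^ 2 - 1) ^ 2 = 0 := by
    field_simp at h
    linear_combination h
  exact sub_eq_zero.1 (pow_eq_zero_iff two_ne_zero |>.1 this)

theorem exists_eq_add_inv {K : Type*} [Field K] [IsAlgClosed K] (t : K) :
    ∃ a : K, a ≠ 0 ∧ t = a + a⁻¹ := by
  obtain ⟨a, ha⟩ := IsAlgClosed.exists_root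
    (Polynomial.C 1 * Polynomial.X ^ 2 + Polynomial.C (-t) * Polynomial.X + Polynomial.C 1 :
      Polynomial K) (by rw [Polynomial.degree_quadratic one_ne_zero]; norm_num)
  simp [Polynomial.IsRoot] at ha
  have h0 : a ≠ 0 := by
    rintro rfl
    simp at ha
  refine ⟨a, h0, ?_⟩
  field_simp
  linear_combination -ha

theorem ne_zero_of_pow_eq_one' {K : Type*} [Field K] {m : ℕ} (hm : m ≠ 0) {a : K}
    (h : a ^ m = 1) : a ≠ 0 := by
  rintro rfl
  rw [zero_pow hm] at h
  exact zero_ne_one h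

theorem sq_ne_four_of_mem_torusTraces {m : ℕ} (hm : m ≠ 0) {t : F} (ht : t ∈ torusTraces F m) :
    t ^ 2 ≠ 4 := by
  obtain ⟨a, ha, ha2, h⟩ := ht
  intro e
  apply ha2
  apply sq_eq_one_of_add_inv (ne_zero_of_pow_eq_one' hm ha)
  rw [← h, ← map_pow, e, map_ofNat]

theorem sq_eq_one_of_pow_eq_one [Finite F] {K : Type*} [Field K] {a : K}
    (h1 : a ^ (Nat.card F - 1) = 1) (h2 : a ^ (Nat.card F + 1) = 1) : a ^ 2 = 1 := by
  have h0 : 0 < Nat.card F := Nat.card_pos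
  have : Nat.card F + 1 = (Nat.card F - 1) + 2 := by omega
  rw [this, pow_add, h1, one_mul] at h2
  exact h2

theorem disjoint_torusTraces [Finite F] {m m' : ℕ} (hm : m ∣ Nat.card F - 1)
    (hm' : m' ∣ Nat.card F + 1) : Disjoint (torusTraces F m) (torusTraces F m') := by
  have hm0 : m ≠ 0 := by
    have : 1 < Nat.card F := Finite.one_lt_card
    rintro rfl
    rw [zero_dvd_iff] at hm
    omega
  have hm0' : m' ≠ 0 := by
    rintro rfl
    rw [zero_dvd_iff] at hm'
    omega
  rw [Set.disjoint_left]
  rintro t ⟨a, ha, ha2, h⟩ ⟨b, hb, -, h'⟩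
  have a0 := ne_zero_of_pow_eq_one' hm0 ha
  have b0 := ne_zero_of_pow_eq_one' hm0' hb
  apply ha2
  obtain ⟨k, hk⟩ := hm
  obtain ⟨k', hk'⟩ := hm'
  apply sq_eq_one_of_pow_eq_one (F := F)
  · rw [hk, pow_mul, ha, one_pow]
  · rw [h, add_inv_eq_iff a0 b0] at h'
    rcases h' with rfl | rfl
    · rw [hk', pow_mul, hb, one_pow]
    · rw [hk', pow_mul, inv_pow, hb, inv_one, one_pow]

theorem natCast_ne_zero_of_dvd [Finite F] (K : Type*) [Field K] [Algebra F K] {m : ℕ}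
    (hm : m ∣ Nat.card F - 1 ∨ m ∣ Nat.card F + 1) : (m : K) ≠ 0 := by
  have h0 : 0 < Nat.card F := Nat.card_pos
  have hc : (Nat.card F : K) = 0 := natCast_card_eq_zero
  intro h
  rcases hm with ⟨k, hk⟩ | ⟨k, hk⟩
  · have := congrArg (Nat.cast : ℕ → K) hk
    rw [Nat.cast_sub h0, hc, Nat.cast_mul, h] at this
    simp at this
  · have := congrArg (Nat.cast : ℕ → K) hk
    rw [Nat.cast_add, hc, Nat.cast_mul, h] at this
    simp at this

/-- As `m` is prime to the characteristic there are `m` roots of unity. Evenness puts both `1` and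
`-1` among them, and `a ↦ a + a⁻¹` is two-to-one on the others. -/
theorem ncard_torusTraces [Finite F] (h2 : (2 : F) ≠ 0) {m : ℕ}
    (hm : m ∣ Nat.card F - 1 ∨ m ∣ Nat.card F + 1) (heven : Even m) :
    2 * (torusTraces F m).ncard + 2 = m := by
  classical
  set K := AlgebraicClosure F
  have hmK : (m : K) ≠ 0 := natCast_ne_zero_of_dvd K hm
  have hm0 : m ≠ 0 := by
    rintro rfl
    simp at hmK
  have : NeZero (m : K) := ⟨hmK⟩
  have : NeZero m := ⟨hm0⟩
  obtain ⟨ζ, hζ⟩ := HasEnoughRootsOfUnity.exists_primitiveRoot K m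
  have h2K : (2 : K) ≠ 0 := by
    have := (map_ne_zero (algebraMap F K)).2 h2
    rwa [map_ofNat] at this
  have h11 : (1 : K) ≠ -1 := by
    intro h
    apply h2K
    linear_combination h
  let R := Polynomial.nthRootsFinset m (1 : K)
  have hR (a : K) : a ∈ R ↔ a ^ m = 1 := Polynomial.mem_nthRootsFinset (Nat.pos_of_ne_zero hm0) _
  have hRc : R.card = m := hζ.card_nthRootsFinset
  let S := R \ {1, -1}
  have hS (a : K) : a ∈ S ↔ a ^ m = 1 ∧ a ^ 2 ≠ 1 := by
    rw [Finset.mem_sdiff, hR, sq_ne_one_iff]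
    simp
  have hSc : S.card + 2 = m := by
    have hsub : ({1, -1} : Finset K) ⊆ R := by
      intro a ha
      rw [hR]
      rcases Finset.mem_insert.1 ha with rfl | ha
      · exact one_pow m
      · rw [Finset.mem_singleton.1 ha, heven.neg_one_pow]
    have := Finset.card_sdiff_add_card_eq_card hsub
    rwa [Finset.card_pair h11, hRc] at this
  have himg : ((S.image fun a => a + a⁻¹ : Finset K) : Set K) =
      algebraMap F K '' torusTraces F m := by
    ext z
    simp only [Finset.coe_image, Set.mem_image, Finset.mem_coe, hS]
    constructor
    · rintro ⟨a, ⟨ha, ha2⟩, rfl⟩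
      obtain ⟨t, ht⟩ := exists_algebraMap_eq_add_inv hm (ne_zero_of_pow_eq_one' hm0 ha) ha
      exact ⟨t, ⟨a, ha, ha2, ht⟩, ht⟩
    · rintro ⟨t, ⟨a, ha, ha2, ht⟩, rfl⟩
      exact ⟨a, ⟨ha, ha2⟩, ht.symm⟩
  have hcard : (torusTraces F m).ncard = (S.image fun a => a + a⁻¹).card := by
    rw [← Set.ncard_coe_finset, himg, Set.ncard_image_of_injective _ (algebraMap F K).injective]
  have hfib : S.card = (S.image fun a => a + a⁻¹).card * 2 := by
    rw [Finset.card_eq_sum_card_image (fun a => a + a⁻¹) S]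
    apply Finset.sum_const_nat
    intro z hz
    obtain ⟨a, ha, rfl⟩ := Finset.mem_image.1 hz
    rw [hS] at ha
    have a0 := ne_zero_of_pow_eq_one' hm0 ha.1
    have hne : a ≠ a⁻¹ := by
      intro h
      apply ha.2
      rw [sq]
      nth_rewrite 2 [h]
      exact mul_inv_cancel₀ a0
    rw [← Finset.card_pair hne]
    congr 1
    ext b
    simp only [Finset.mem_filter, hS, Finset.mem_insert, Finset.mem_singleton]
    constructor
    · rintro ⟨⟨hb, -⟩, e⟩
      exact (add_inv_eq_iff (ne_zero_of_pow_eq_one' hm0 hb) a0).1 e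
    · rintro (rfl | rfl)
      · exact ⟨ha, rfl⟩
      · refine ⟨⟨by rw [inv_pow, ha.1, inv_one], ?_⟩, by rw [inv_inv, add_comm]⟩
        rw [inv_pow, ne_eq, inv_eq_one]
        exact ha.2
  omega

/-- Here `a ^ q = a`, so the eigenvalues `a ≠ a⁻¹` already lie in `F`. -/
theorem card_roots_of_mem_torusTraces_sub_one [Finite F] {m : ℕ} (hm : m ∣ Nat.card F - 1)
    {t : F} (ht : t ∈ torusTraces F m) : Nat.card {x : F // x * (t - x) = 1} = 2 := by
  obtain ⟨a, ha, ha2, h⟩ := ht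
  have h0 : 0 < Nat.card F := Nat.card_pos
  obtain ⟨k, hk⟩ := hm
  have haq : a ^ Nat.card F = a := by
    rw [← Nat.sub_add_cancel h0, pow_succ, hk, pow_mul, ha, one_pow, one_mul]
  obtain ⟨x, rfl⟩ := mem_range_algebraMap_of_pow_card haq
  have hx0 : x ≠ 0 := by
    rintro rfl
    have h1 : 1 < Nat.card F := Finite.one_lt_card
    have : m ≠ 0 := by
      rintro rfl
      omega
    rw [map_zero, zero_pow this] at ha
    exact zero_ne_one ha
  have ht : t = x + x⁻¹ := by
    apply (algebraMap F (AlgebraicClosure F)).injective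
    rw [h, map_add, map_inv₀]
  have hx2 : x ≠ x⁻¹ := by
    intro e
    apply ha2
    have : x ^ 2 = 1 := by
      rw [sq]
      nth_rewrite 2 [e]
      exact mul_inv_cancel₀ hx0
    rw [← map_pow, this, map_one]
  change Nat.card ({y : F | y * (t - y) = 1} : Set F) = 2
  rw [Nat.card_coe_set_eq, ← Set.ncard_pair hx2]
  congr 1
  ext y
  simp only [Set.mem_ofPred_eq, Set.mem_insert_iff, Set.mem_singleton_iff]
  rw [ht]
  constructor
  · intro e
    have : (y - x) * (y - x⁻¹) = 0 := by
      field_simp at e ⊢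
      linear_combination -e
    rcases mul_eq_zero.1 this with h | h
    · exact Or.inl (sub_eq_zero.1 h)
    · exact Or.inr (sub_eq_zero.1 h)
  · rintro (rfl | rfl) <;> field_simp <;> ring

/-- A root in `F` would put `a` in `F`, so that `a ^ (q - 1) = 1` as well as `a ^ (q + 1) = 1`,
forcing `a ^ 2 = 1`. -/
theorem card_roots_of_mem_torusTraces_add_one [Finite F] {m : ℕ} (hm : m ∣ Nat.card F + 1)
    {t : F} (ht : t ∈ torusTraces F m) : Nat.card {x : F // x * (t - x) = 1} = 0 := by
  obtain ⟨a, ha, ha2, h⟩ := ht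
  have h1 : 0 < Nat.card F := Nat.card_pos
  obtain ⟨k, hk⟩ := hm
  have haq : a ^ (Nat.card F + 1) = 1 := by rw [hk, pow_mul, ha, one_pow]
  have a0 := ne_zero_of_pow_eq_one' (Nat.succ_ne_zero _) haq
  rw [Nat.card_eq_zero]
  left
  refine ⟨fun ⟨x, hx⟩ => ha2 ?_⟩
  have key (y : F) (e : a = algebraMap F (AlgebraicClosure F) y) : a ^ 2 = 1 := by
    apply sq_eq_one_of_pow_eq_one (F := F) _ haq
    apply mul_left_cancel₀ a0
    rw [← pow_succ', Nat.sub_add_cancel h1, mul_one, e, algebraMap_pow_card]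
  have hx0 : x ≠ 0 := by
    rintro rfl
    simp at hx
  have ht : t = x + x⁻¹ := by
    field_simp
    linear_combination hx
  rw [ht, map_add, map_inv₀, eq_comm, add_inv_eq_iff a0 ((map_ne_zero _).2 hx0)] at h
  rcases h with h | h
  · exact key x h
  · exact key x⁻¹ (by rw [h, map_inv₀])

theorem card_roots_of_sq_eq_four {t : F} (h2 : (2 : F) ≠ 0) (ht : t ^ 2 = 4) :
    Nat.card {x : F // x * (t - x) = 1} = 1 := by
  have h4 : (4 : F) ≠ 0 := by
    have : (4 : F) = 2 * 2 := by norm_num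
    rw [this]
    exact mul_ne_zero h2 h2
  change Nat.card ({y : F | y * (t - y) = 1} : Set F) = 1
  rw [Nat.card_coe_set_eq, Set.ncard_eq_one]
  refine ⟨t / 2, ?_⟩
  ext y
  simp only [Set.mem_ofPred_eq, Set.mem_singleton_iff]
  constructor
  · intro e
    have : (2 * y - t) ^ 2 = 0 := by linear_combination ht - 4 * e
    have := pow_eq_zero_iff two_ne_zero |>.1 this
    field_simp
    linear_combination this
  · rintro rfl
    apply mul_left_cancel₀ h4
    field_simp
    linear_combination ht

end TorusTraces

/-! ### The set of `n`-th powers and its cardinality. -/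

section Counting

variable {F : Type u} [Field F]

theorem tr_sq_eq_four_iff {t : F} : t ^ 2 = 4 ↔ t = 2 * 1 ∨ t = 2 * (-1) := by
  rw [show (4 : F) = 2 ^ 2 by norm_num, sq_eq_sq_iff_eq_or_eq_neg]
  simp

theorem tr_pow_mem_torusTraces [Finite F] {n : ℕ} (x : SpecialLinearGroup (Fin 2) F)
    (h : SL2.tr (x ^ n) ^ 2 ≠ 4) :
    SL2.tr (x ^ n) ∈ torusTraces F ((Nat.card F - 1) / (Nat.card F - 1).gcd n) ∪
      torusTraces F ((Nat.card F + 1) / (Nat.card F + 1).gcd n) := by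
  obtain ⟨a, a0, ha⟩ := exists_eq_add_inv (algebraMap F (AlgebraicClosure F) (SL2.tr x))
  have hp := SL2.tr_pow x a0 ha n
  have hne : (a ^ n) ^ 2 ≠ 1 := by
    intro e
    apply h
    apply (algebraMap F (AlgebraicClosure F)).injective
    rw [map_pow, hp, map_ofNat]
    have := pow_ne_zero n a0
    field_simp
    linear_combination ((a ^ n) ^ 2 - 1) * e
  have key (N : ℕ) (hN : a ^ N = 1) : (a ^ n) ^ (N / N.gcd n) = 1 := by
    obtain ⟨k, hk⟩ := Nat.gcd_dvd_right N n
    rw [← pow_mul]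
    nth_rewrite 1 [hk]
    rw [mul_right_comm, Nat.mul_div_cancel' (Nat.gcd_dvd_left N n), pow_mul, hN, one_pow]
  rcases pow_card_sub_one_or_add_one a0 ha with e | e
  · exact Or.inl ⟨a ^ n, key _ e, hne, hp⟩
  · exact Or.inr ⟨a ^ n, key _ e, hne, hp⟩

/-- The eigenvalue `b` has an `n`-th root `a` among the `N`-th roots of unity. Since `a + a⁻¹` lies
in `F`, any matrix with that trace serves as `x`. -/
theorem exists_tr_pow_eq [Finite F] {n N : ℕ} (hN : N = Nat.card F - 1 ∨ N = Nat.card F + 1) {t : F}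
    (ht : t ∈ torusTraces F (N / N.gcd n)) :
    ∃ x : SpecialLinearGroup (Fin 2) F, SL2.tr (x ^ n) = t := by
  obtain ⟨b, hb, -, h⟩ := ht
  have hNd : N ∣ Nat.card F - 1 ∨ N ∣ Nat.card F + 1 := by
    rcases hN with rfl | rfl
    · exact Or.inl dvd_rfl
    · exact Or.inr dvd_rfl
  have hN0 : 0 < N := by
    have : 1 < Nat.card F := Finite.one_lt_card
    omega
  have : NeZero (N : AlgebraicClosure F) := ⟨natCast_ne_zero_of_dvd _ hNd⟩
  obtain ⟨ζ, hζ⟩ := HasEnoughRootsOfUnity.exists_primitiveRoot (AlgebraicClosure F) N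
  obtain ⟨a, ha, rfl⟩ := exists_pow_eq_of_pow_div_gcd_eq_one hN0 hζ hb
  have a0 := ne_zero_of_pow_eq_one' hN0.ne' ha
  obtain ⟨s, hs⟩ := exists_algebraMap_eq_add_inv hNd a0 ha
  refine ⟨twistedCompanion 1 s, ?_⟩
  apply (algebraMap F (AlgebraicClosure F)).injective
  rw [h, SL2.tr_pow _ a0 (by rw [tr_twistedCompanion]; exact hs)]

/-- Away from trace `± 2` a power with the same trace as `g` is conjugate to `g`, and conjugates of
`n`-th powers are `n`-th powers. -/
theorem exists_pow_eq_of_tr_mem [Finite F] (h2 : (2 : F) ≠ 0) {n N : ℕ}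
    (hN : N = Nat.card F - 1 ∨ N = Nat.card F + 1) {g : SpecialLinearGroup (Fin 2) F}
    (hg : SL2.tr g ∈ torusTraces F (N / N.gcd n)) :
    ∃ x : SpecialLinearGroup (Fin 2) F, x ^ n = g := by
  obtain ⟨x, hx⟩ := exists_tr_pow_eq hN hg
  have hm : N / N.gcd n ≠ 0 := by
    have h1 : 1 < Nat.card F := Finite.one_lt_card
    have hN0 : 0 < N := by omega
    exact (Nat.div_pos (Nat.le_of_dvd hN0 (Nat.gcd_dvd_left N n))
      (Nat.gcd_pos_of_pos_left _ hN0)).ne'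
  have := isConj_of_tr_eq h2 (hx ▸ sq_ne_four_of_mem_torusTraces hm hg) hx
  obtain ⟨c, hc⟩ := isConj_iff.1 this
  exact ⟨c * x * c⁻¹, by rw [conj_pow, hc]⟩

theorem SL2.tr_one : SL2.tr (1 : SpecialLinearGroup (Fin 2) F) = 2 := by
  simp [SL2.tr]; norm_num

theorem SL2.tr_neg_one : SL2.tr (-1 : SpecialLinearGroup (Fin 2) F) = -2 := by
  simp [SL2.tr]; norm_num

theorem SL2.one_ne_neg_one (h2 : (2 : F) ≠ 0) :
    (1 : SpecialLinearGroup (Fin 2) F) ≠ -1 := by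
  intro h
  have := congrArg SL2.tr h
  rw [SL2.tr_one, SL2.tr_neg_one] at this
  have h4 : (2 : F) * 2 = 0 := by linear_combination this
  exact (mul_ne_zero h2 h2) h4

/-- In characteristic `n`, the `n`-th powers with eigenvalues `± 1` are `± 1`. -/
theorem pow_eq_one_or_neg_one {n : ℕ} (hn : n.Prime) (hnF : (n : F) = 0)
    (x : SpecialLinearGroup (Fin 2) F) (h : SL2.tr (x ^ n) ^ 2 = 4) : x ^ n = 1 ∨ x ^ n = -1 := by
  have := Fact.mk hn
  have hF : CharP F n := (CharP.charP_iff_prime_eq_zero hn).2 hnF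
  have hK : CharP (AlgebraicClosure F) n :=
    charP_of_injective_algebraMap (algebraMap F (AlgebraicClosure F)).injective n
  obtain ⟨a, a0, ha⟩ := exists_eq_add_inv (algebraMap F (AlgebraicClosure F) (SL2.tr x))
  have hp := SL2.tr_pow x a0 ha n
  have h1 : (a ^ n) ^ 2 = 1 := by
    apply sq_eq_one_of_add_inv (pow_ne_zero _ a0)
    rw [← hp, ← map_pow, h, map_ofNat]
  -- In characteristic `n` raising to the `n`-th power is injective, so `x` itself already has the
  -- double eigenvalue `± 1`.
  have h3 : a ^ 2 = 1 := by
    apply frobenius_inj (AlgebraicClosure F) n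
    rw [frobenius_def, frobenius_def, one_pow, ← pow_mul, mul_comm, pow_mul, h1]
  have hx : SL2.tr x ^ 2 = 4 := by
    apply (algebraMap F (AlgebraicClosure F)).injective
    rw [map_pow, ha, map_ofNat]
    field_simp
    linear_combination (a ^ 2 - 1) * h3
  rcases tr_sq_eq_four_iff.1 hx with e | e
  · exact SL2.pow_eq_of_tr hnF (by ring) e
  · exact SL2.pow_eq_of_tr hnF (by ring) e

theorem setOf_pow_eq_of_natCast_ne_zero [Finite F] (h2 : (2 : F) ≠ 0) {n : ℕ} (hn : Odd n)
    (hnF : (n : F) ≠ 0) :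
    {g : SpecialLinearGroup (Fin 2) F | ∃ x, x ^ n = g} =
      ({g | SL2.tr g ∈ torusTraces F ((Nat.card F - 1) / (Nat.card F - 1).gcd n)} ∪
        {g | SL2.tr g ∈ torusTraces F ((Nat.card F + 1) / (Nat.card F + 1).gcd n)}) ∪
      {g | SL2.tr g ∈ {t : F | t ^ 2 = 4}} := by
  ext g
  constructor
  · rintro ⟨x, rfl⟩
    by_cases h : SL2.tr (x ^ n) ^ 2 = 4
    · exact Or.inr h
    · exact Or.inl (tr_pow_mem_torusTraces x h)
  · rintro ((h | h) | h)
    · exact exists_pow_eq_of_tr_mem h2 (Or.inl rfl) h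
    · exact exists_pow_eq_of_tr_mem h2 (Or.inr rfl) h
    · rcases tr_sq_eq_four_iff.1 h with e | e
      · exact SL2.exists_pow_eq_of_tr hn hnF (by ring) e
      · exact SL2.exists_pow_eq_of_tr hn hnF (by ring) e

theorem setOf_pow_eq_of_natCast_eq_zero [Finite F] (h2 : (2 : F) ≠ 0) {n : ℕ} (hp : n.Prime) (hn : Odd n)
    (hnF : (n : F) = 0) :
    {g : SpecialLinearGroup (Fin 2) F | ∃ x, x ^ n = g} =
      ({g | SL2.tr g ∈ torusTraces F ((Nat.card F - 1) / (Nat.card F - 1).gcd n)} ∪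
        {g | SL2.tr g ∈ torusTraces F ((Nat.card F + 1) / (Nat.card F + 1).gcd n)}) ∪
      {1, -1} := by
  ext g
  constructor
  · rintro ⟨x, rfl⟩
    by_cases h : SL2.tr (x ^ n) ^ 2 = 4
    · exact Or.inr (pow_eq_one_or_neg_one hp hnF x h)
    · exact Or.inl (tr_pow_mem_torusTraces x h)
  · rintro ((h | h) | (h | h))
    · exact exists_pow_eq_of_tr_mem h2 (Or.inl rfl) h
    · exact exists_pow_eq_of_tr_mem h2 (Or.inr rfl) h
    · exact ⟨1, by rw [one_pow, h]⟩
    · exact ⟨-1, by rw [hn.neg_one_pow, h]⟩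

theorem ncard_setOf_tr_torusTraces [Finite F] {m m' : ℕ} (hm : m ∣ Nat.card F - 1)
    (hm' : m' ∣ Nat.card F + 1) {E : Set (SpecialLinearGroup (Fin 2) F)}
    (hE : ∀ g ∈ E, SL2.tr g ^ 2 = 4) :
    Set.ncard (({g : SpecialLinearGroup (Fin 2) F | SL2.tr g ∈ torusTraces F m} ∪
        {g | SL2.tr g ∈ torusTraces F m'}) ∪ E) =
      (torusTraces F m).ncard * (Nat.card F * (Nat.card F + 1)) +
      (torusTraces F m').ncard * (Nat.card F * (Nat.card F - 1)) + E.ncard := by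
  have h1 : 1 < Nat.card F := Finite.one_lt_card
  have hm0 : m ≠ 0 := by
    rintro rfl
    rw [zero_dvd_iff] at hm
    omega
  have hm0' : m' ≠ 0 := by
    rintro rfl
    rw [zero_dvd_iff] at hm'
    omega
  rw [Set.ncard_union_eq, Set.ncard_union_eq, ncard_setOf_tr_mem, ncard_setOf_tr_mem]
  · intro t ht
    rw [card_traceFibre, card_roots_of_mem_torusTraces_add_one hm' ht, zero_mul, add_zero]
  · intro t ht
    rw [card_traceFibre, card_roots_of_mem_torusTraces_sub_one hm ht, mul_comm 2, ← mul_add]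
    congr 1
    omega
  · rw [Set.disjoint_left]
    exact fun g hg hg' => Set.disjoint_left.1 (disjoint_torusTraces hm hm') hg hg'
  · rw [Set.disjoint_left]
    rintro g (hg | hg) hg'
    · exact sq_ne_four_of_mem_torusTraces hm0 hg (hE g hg')
    · exact sq_ne_four_of_mem_torusTraces hm0' hg (hE g hg')

theorem two_ne_neg_two (h2 : (2 : F) ≠ 0) : (2 : F) ≠ -2 := by
  intro h
  exact mul_ne_zero h2 h2 (by linear_combination h)

theorem ncard_setOf_tr_sq_eq_four [Finite F] (h2 : (2 : F) ≠ 0) :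
    Set.ncard {g : SpecialLinearGroup (Fin 2) F | SL2.tr g ∈ {t : F | t ^ 2 = 4}} =
      2 * Nat.card F ^ 2 := by
  have h1 : 0 < Nat.card F := Nat.card_pos
  rw [ncard_setOf_tr_mem _ (Nat.card F ^ 2)]
  · have : {t : F | t ^ 2 = 4} = {2, -2} := by
      ext t
      rw [Set.mem_ofPred_eq, tr_sq_eq_four_iff]
      simp
    rw [this, Set.ncard_pair (two_ne_neg_two h2)]
  · intro t ht
    rw [card_traceFibre, card_roots_of_sq_eq_four h2 ht, one_mul, ← Nat.mul_succ, sq]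
    congr 1
    omega

theorem numPowers_eq_of_natCast_ne_zero [Finite F] (h2 : (2 : F) ≠ 0) {n : ℕ} (hn : Odd n)
    (hnF : (n : F) ≠ 0) :
    numPowers n F =
      (torusTraces F ((Nat.card F - 1) / (Nat.card F - 1).gcd n)).ncard *
        (Nat.card F * (Nat.card F + 1)) +
      (torusTraces F ((Nat.card F + 1) / (Nat.card F + 1).gcd n)).ncard *
        (Nat.card F * (Nat.card F - 1)) + 2 * Nat.card F ^ 2 := by
  rw [numPowers, setOf_pow_eq_of_natCast_ne_zero h2 hn hnF,
    ncard_setOf_tr_torusTraces (Nat.div_dvd_of_dvd (Nat.gcd_dvd_left _ _))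
      (Nat.div_dvd_of_dvd (Nat.gcd_dvd_left _ _)) (E := {g | SL2.tr g ∈ {t : F | t ^ 2 = 4}})
      (fun g hg => hg),
    ncard_setOf_tr_sq_eq_four h2]

theorem numPowers_eq_of_natCast_eq_zero [Finite F] (h2 : (2 : F) ≠ 0) {n : ℕ} (hp : n.Prime) (hn : Odd n)
    (hnF : (n : F) = 0) :
    numPowers n F =
      (torusTraces F ((Nat.card F - 1) / (Nat.card F - 1).gcd n)).ncard *
        (Nat.card F * (Nat.card F + 1)) +
      (torusTraces F ((Nat.card F + 1) / (Nat.card F + 1).gcd n)).ncard *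
        (Nat.card F * (Nat.card F - 1)) + 2 := by
  rw [numPowers, setOf_pow_eq_of_natCast_eq_zero h2 hp hn hnF,
    ncard_setOf_tr_torusTraces (Nat.div_dvd_of_dvd (Nat.gcd_dvd_left _ _))
      (Nat.div_dvd_of_dvd (Nat.gcd_dvd_left _ _)),
    Set.ncard_pair (SL2.one_ne_neg_one h2)]
  rintro g (rfl | rfl)
  · rw [SL2.tr_one]; norm_num
  · rw [SL2.tr_neg_one]; norm_num

end Counting

/-! ### The number of conjugacy classes of `n`-th powers. -/

section Classes

variable {F : Type u} [Field F]

theorem setOf_isPowerClass (n : ℕ) :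
    {C : ConjClasses (SpecialLinearGroup (Fin 2) F) | IsPowerClass n C} =
      ConjClasses.mk '' {g : SpecialLinearGroup (Fin 2) F | ∃ x, x ^ n = g} := by
  ext C
  constructor
  · rintro ⟨x, hx⟩
    exact ⟨x ^ n, ⟨x, rfl⟩, hx⟩
  · rintro ⟨_, ⟨x, rfl⟩, hx⟩
    exact ⟨x, hx⟩

/-- The case `n = 1` turns the counts of powers into the order of the group and, in the next lemma,
its class number. -/
theorem numPowers_one : numPowers 1 F = Nat.card (SpecialLinearGroup (Fin 2) F) := by
  rw [numPowers, ← Set.ncard_univ]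
  congr 1
  ext g
  simp

theorem numPowerClasses_one :
    numPowerClasses 1 F = Nat.card (ConjClasses (SpecialLinearGroup (Fin 2) F)) := by
  rw [numPowerClasses, setOf_isPowerClass, ← Set.ncard_univ]
  congr 1
  rw [Set.eq_univ_iff_forall]
  intro C
  obtain ⟨g, rfl⟩ := ConjClasses.mk_surjective C
  exact ⟨g, ⟨g, pow_one g⟩, rfl⟩

theorem image_mk_setOf_tr_mem [Finite F] (h2 : (2 : F) ≠ 0) {U : Set F} (hU : ∀ t ∈ U, t ^ 2 ≠ 4) :
    ConjClasses.mk '' {g : SpecialLinearGroup (Fin 2) F | SL2.tr g ∈ U} =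
      (fun t => ConjClasses.mk (twistedCompanion 1 t)) '' U := by
  ext C
  constructor
  · rintro ⟨g, hg, rfl⟩
    exact ⟨SL2.tr g, hg, ConjClasses.mk_eq_mk_iff_isConj.2
      (isConj_twistedCompanion_one h2 g (hU _ hg)).symm⟩
  · rintro ⟨t, ht, rfl⟩
    exact ⟨_, by simpa using ht, rfl⟩

theorem ncard_image_mk_twistedCompanion (μ : Fˣ) (U : Set F) :
    ((fun t => ConjClasses.mk (twistedCompanion μ t)) '' U).ncard = U.ncard := by
  apply Set.ncard_image_of_injective
  intro s t h
  simpa using SL2.tr_eq_of_isConj (ConjClasses.mk_eq_mk_iff_isConj.1 h)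

theorem ncard_image_mk_torusTraces [Finite F] (h2 : (2 : F) ≠ 0) {m m' : ℕ} (hm : m ∣ Nat.card F - 1)
    (hm' : m' ∣ Nat.card F + 1) {E : Set (SpecialLinearGroup (Fin 2) F)}
    (hE : ∀ g ∈ E, SL2.tr g ^ 2 = 4) :
    Set.ncard (ConjClasses.mk ''
      (({g : SpecialLinearGroup (Fin 2) F | SL2.tr g ∈ torusTraces F m} ∪
        {g | SL2.tr g ∈ torusTraces F m'}) ∪ E)) =
      (torusTraces F m).ncard + (torusTraces F m').ncard + (ConjClasses.mk '' E).ncard := by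
  have h1 : 1 < Nat.card F := Finite.one_lt_card
  have hm0 : m ≠ 0 := by
    rintro rfl
    rw [zero_dvd_iff] at hm
    omega
  have hm0' : m' ≠ 0 := by
    rintro rfl
    rw [zero_dvd_iff] at hm'
    omega
  have hU : ∀ t ∈ torusTraces F m ∪ torusTraces F m', t ^ 2 ≠ 4 := by
    rintro t (ht | ht)
    · exact sq_ne_four_of_mem_torusTraces hm0 ht
    · exact sq_ne_four_of_mem_torusTraces hm0' ht
  have := image_mk_setOf_tr_mem h2 hU
  have e : {g : SpecialLinearGroup (Fin 2) F | SL2.tr g ∈ torusTraces F m} ∪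
      {g | SL2.tr g ∈ torusTraces F m'} =
      {g | SL2.tr g ∈ torusTraces F m ∪ torusTraces F m'} := rfl
  have hfin : Finite (ConjClasses (SpecialLinearGroup (Fin 2) F)) :=
    Finite.of_surjective _ ConjClasses.mk_surjective
  rw [Set.image_union, e, this, Set.ncard_union_eq, ncard_image_mk_twistedCompanion,
    Set.ncard_union_eq (disjoint_torusTraces hm hm')]
  rw [Set.disjoint_left]
  rintro _ ⟨t, ht, rfl⟩ ⟨g, hg, h⟩
  have := SL2.tr_eq_of_isConj (ConjClasses.mk_eq_mk_iff_isConj.1 h)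
  rw [tr_twistedCompanion] at this
  exact hU t ht (this ▸ hE g hg)

theorem ncard_image_mk_one_neg_one (h2 : (2 : F) ≠ 0) :
    (ConjClasses.mk '' ({1, -1} : Set (SpecialLinearGroup (Fin 2) F))).ncard = 2 := by
  rw [Set.image_pair, Set.ncard_pair]
  intro h
  have := SL2.tr_eq_of_isConj (ConjClasses.mk_eq_mk_iff_isConj.1 h)
  rw [SL2.tr_one, SL2.tr_neg_one] at this
  exact two_ne_neg_two h2 this

theorem exists_not_isSquare_unit [Finite F] (h2 : (2 : F) ≠ 0) : ∃ δ : Fˣ, ¬ IsSquare (δ : F) := by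
  have := Fintype.ofFinite F
  obtain ⟨d, hd⟩ := FiniteField.exists_nonsquare (F := F) (by
    intro hch
    have := ringChar.Nat.cast_ringChar (R := F)
    rw [hch] at this
    exact h2 (by exact_mod_cast this))
  have : d ≠ 0 := by
    rintro rfl
    exact hd (IsSquare.zero)
  exact ⟨Units.mk0 d this, hd⟩

/-- There are three classes with the double eigenvalue `ε`. -/
theorem ncard_image_mk_setOf_tr_eq [Finite F] (h2 : (2 : F) ≠ 0) {ε : F} (hε : ε = 1 ∨ ε = -1)
    {δ : Fˣ} (hδ : ¬ IsSquare (δ : F)) (z : SpecialLinearGroup (Fin 2) F)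
    (hz : z = 1 ∧ ε = 1 ∨ z = -1 ∧ ε = -1) :
    (ConjClasses.mk '' {g : SpecialLinearGroup (Fin 2) F | SL2.tr g = 2 * ε}).ncard = 3 := by
  have hε2 : ε ^ 2 = 1 := sq_eq_one_iff.2 hε
  have hzt : SL2.tr z = 2 * ε := by
    rcases hz with ⟨rfl, rfl⟩ | ⟨rfl, rfl⟩
    · rw [SL2.tr_one, mul_one]
    · rw [SL2.tr_neg_one, mul_neg_one]
  -- The central element `z` is conjugate only to itself, while a companion matrix has the nonzero
  -- lower left entry `μ`.
  have hzc (μ : Fˣ) (h : IsConj z (twistedCompanion μ (2 * ε))) : False := by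
    obtain ⟨c, hc⟩ := isConj_iff.1 h
    have e : z = twistedCompanion μ (2 * ε) := by
      rw [← hc]
      rcases hz with ⟨rfl, -⟩ | ⟨rfl, -⟩ <;> simp
    have := congrArg (fun g => g 1 0) e
    rcases hz with ⟨rfl, -⟩ | ⟨rfl, -⟩ <;> simp [twistedCompanion] at this
    · exact μ.ne_zero this.symm
    · exact μ.ne_zero this.symm
  have himg : ConjClasses.mk '' {g : SpecialLinearGroup (Fin 2) F | SL2.tr g = 2 * ε} =
      {ConjClasses.mk z, ConjClasses.mk (twistedCompanion 1 (2 * ε)),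
        ConjClasses.mk (twistedCompanion δ (2 * ε))} := by
    ext C
    constructor
    · rintro ⟨g, hg, rfl⟩
      have hg : SL2.tr g = 2 * ε := hg
      rcases eq_one_or_neg_one_or_isConj_twistedCompanion g with h | h | ⟨μ, h⟩
      · left
        rcases hz with ⟨rfl, -⟩ | ⟨rfl, he⟩
        · rw [h]
        · rw [h, SL2.tr_one, he] at hg
          exact absurd (by linear_combination hg) (two_ne_neg_two h2)
      · left
        rcases hz with ⟨rfl, he⟩ | ⟨rfl, -⟩
        · rw [h, SL2.tr_neg_one, he] at hg
          exact absurd (by linear_combination -hg) (two_ne_neg_two h2)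
        · rw [h]
      · right
        rw [hg] at h
        rcases isConj_twistedCompanion_one_or h2 hδ μ (2 * ε) with h' | h'
        · exact Or.inl (ConjClasses.mk_eq_mk_iff_isConj.2 (h.trans h'))
        · exact Or.inr (ConjClasses.mk_eq_mk_iff_isConj.2 (h.trans h'))
    · rintro (rfl | rfl | rfl)
      · exact ⟨z, hzt, rfl⟩
      · exact ⟨_, tr_twistedCompanion _ _, rfl⟩
      · exact ⟨_, tr_twistedCompanion _ _, rfl⟩
  rw [himg, Set.ncard_eq_three]
  refine ⟨_, _, _, fun h => hzc _ (ConjClasses.mk_eq_mk_iff_isConj.1 h),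
    fun h => hzc _ (ConjClasses.mk_eq_mk_iff_isConj.1 h), fun h => ?_, rfl⟩
  -- If the two noncentral classes coincided, the square class invariant would make `δ` a square.
  obtain ⟨s, hs⟩ :=
    exists_sq_mul_of_isConj_twistedCompanion hε2 (ConjClasses.mk_eq_mk_iff_isConj.1 h.symm)
  exact hδ ⟨s, by rw [hs]; simp [sq]⟩

theorem ncard_image_mk_setOf_tr_sq_eq_four [Finite F] (h2 : (2 : F) ≠ 0) :
    (ConjClasses.mk '' {g : SpecialLinearGroup (Fin 2) F |
      SL2.tr g ∈ {t : F | t ^ 2 = 4}}).ncard = 6 := by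
  obtain ⟨δ, hδ⟩ := exists_not_isSquare_unit h2
  have hfin : Finite (ConjClasses (SpecialLinearGroup (Fin 2) F)) :=
    Finite.of_surjective _ ConjClasses.mk_surjective
  have e : {g : SpecialLinearGroup (Fin 2) F | SL2.tr g ∈ {t : F | t ^ 2 = 4}} =
      {g | SL2.tr g = 2 * 1} ∪ {g | SL2.tr g = 2 * (-1)} := by
    ext g
    exact tr_sq_eq_four_iff
  rw [e, Set.image_union, Set.ncard_union_eq,
    ncard_image_mk_setOf_tr_eq h2 (Or.inl rfl) hδ 1 (Or.inl ⟨rfl, rfl⟩),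
    ncard_image_mk_setOf_tr_eq h2 (Or.inr rfl) hδ (-1) (Or.inr ⟨rfl, rfl⟩)]
  rw [Set.disjoint_left]
  rintro _ ⟨g, hg, rfl⟩ ⟨h, hh, e⟩
  have := SL2.tr_eq_of_isConj (ConjClasses.mk_eq_mk_iff_isConj.1 e)
  have hg : SL2.tr g = 2 * 1 := hg
  have hh : SL2.tr h = 2 * (-1) := hh
  rw [hg, hh] at this
  exact two_ne_neg_two h2 (by linear_combination -this)

theorem numPowerClasses_eq_of_natCast_ne_zero [Finite F] (h2 : (2 : F) ≠ 0) {n : ℕ} (hn : Odd n)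
    (hnF : (n : F) ≠ 0) :
    numPowerClasses n F =
      (torusTraces F ((Nat.card F - 1) / (Nat.card F - 1).gcd n)).ncard +
      (torusTraces F ((Nat.card F + 1) / (Nat.card F + 1).gcd n)).ncard + 6 := by
  rw [numPowerClasses, setOf_isPowerClass, setOf_pow_eq_of_natCast_ne_zero h2 hn hnF,
    ncard_image_mk_torusTraces h2 (Nat.div_dvd_of_dvd (Nat.gcd_dvd_left _ _))
      (Nat.div_dvd_of_dvd (Nat.gcd_dvd_left _ _)) (E := {g | SL2.tr g ∈ {t : F | t ^ 2 = 4}})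
      (fun g hg => hg),
    ncard_image_mk_setOf_tr_sq_eq_four h2]

theorem numPowerClasses_eq_of_natCast_eq_zero [Finite F] (h2 : (2 : F) ≠ 0) {n : ℕ} (hp : n.Prime)
    (hn : Odd n) (hnF : (n : F) = 0) :
    numPowerClasses n F =
      (torusTraces F ((Nat.card F - 1) / (Nat.card F - 1).gcd n)).ncard +
      (torusTraces F ((Nat.card F + 1) / (Nat.card F + 1).gcd n)).ncard + 2 := by
  rw [numPowerClasses, setOf_isPowerClass, setOf_pow_eq_of_natCast_eq_zero h2 hp hn hnF,
    ncard_image_mk_torusTraces h2 (Nat.div_dvd_of_dvd (Nat.gcd_dvd_left _ _))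
      (Nat.div_dvd_of_dvd (Nat.gcd_dvd_left _ _)),
    ncard_image_mk_one_neg_one h2]
  rintro g (rfl | rfl)
  · rw [SL2.tr_one]; norm_num
  · rw [SL2.tr_neg_one]; norm_num

end Classes

/-! ### Closed formulas and proportions. -/

section Formulas

variable {F : Type u} [Field F] [Finite F]

theorem two_ne_zero_of_odd_card (hq : Odd (Nat.card F)) : (2 : F) ≠ 0 := by
  intro h
  obtain ⟨k, hk⟩ := hq
  have h0 : (Nat.card F : F) = 0 := natCast_card_eq_zero
  rw [hk] at h0
  push_cast at h0
  rw [h, zero_mul, zero_add] at h0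
  exact one_ne_zero h0

theorem natCast_eq_zero_iff_dvd_card {n : ℕ} (hn : n.Prime) :
    (n : F) = 0 ↔ n ∣ Nat.card F := by
  have := Fintype.ofFinite F
  constructor
  · intro h
    have := (CharP.charP_iff_prime_eq_zero hn).2 h
    exact (CharP.cast_eq_zero_iff F n _).1 natCast_card_eq_zero
  · intro h
    obtain ⟨p, hp⟩ := CharP.exists F
    obtain ⟨k, hp', hk⟩ := FiniteField.card F p
    rw [Nat.card_eq_fintype_card, hk] at h
    rw [(Nat.prime_dvd_prime_iff_eq hn hp').1 (hn.dvd_of_dvd_pow h)]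
    exact CharP.cast_eq_zero F p

theorem two_mul_ncard_torusTraces (hq : Odd (Nat.card F)) {n N : ℕ} (hn : Odd n)
    (hN : N = Nat.card F - 1 ∨ N = Nat.card F + 1) :
    2 * (torusTraces F (N / N.gcd n)).ncard + 2 = N / N.gcd n := by
  have hd : N / N.gcd n ∣ N := Nat.div_dvd_of_dvd (Nat.gcd_dvd_left _ _)
  apply ncard_torusTraces (two_ne_zero_of_odd_card hq)
  · rcases hN with rfl | rfl
    · exact Or.inl hd
    · exact Or.inr hd
  -- `N = q ∓ 1` is even and its gcd with the odd `n` is odd, so the quotient stays even.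
  · have hg : Odd (N.gcd n) := hn.of_dvd_nat (Nat.gcd_dvd_right _ _)
    have hNe : Even N := by
      obtain ⟨k, hk⟩ := hq
      rcases hN with rfl | rfl
      · exact ⟨k, by omega⟩
      · exact ⟨k + 1, by omega⟩
    rw [← Nat.mul_div_cancel' (Nat.gcd_dvd_left N n), Nat.even_mul] at hNe
    exact hNe.resolve_left (Nat.not_even_iff_odd.2 hg)

/-- The numbers of power classes and of powers, in terms of the indices `d`, `d'` of the `n`-th
powers in the split and in the nonsplit torus. -/
theorem power_counts (hq : Odd (Nat.card F)) {n : ℕ} (hn : Odd n) {d d' : ℕ}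
    (hd : (Nat.card F - 1).gcd n = d) (hd' : (Nat.card F + 1).gcd n = d') :
    ((n : F) ≠ 0 →
      (numPowerClasses n F : ℝ) =
        ((Nat.card F : ℝ) - 1) / (2 * d) + ((Nat.card F : ℝ) + 1) / (2 * d') + 4 ∧
      (numPowers n F : ℝ) = ((Nat.card F : ℝ) ^ 3 - Nat.card F) * (1 / (2 * d) + 1 / (2 * d'))) ∧
    (n.Prime → (n : F) = 0 →
      (numPowerClasses n F : ℝ) =
        ((Nat.card F : ℝ) - 1) / (2 * d) + ((Nat.card F : ℝ) + 1) / (2 * d') ∧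
      (numPowers n F : ℝ) = ((Nat.card F : ℝ) ^ 3 - Nat.card F) * (1 / (2 * d) + 1 / (2 * d'))
        - 2 * (Nat.card F : ℝ) ^ 2 + 2) := by
  have h2 := two_ne_zero_of_odd_card hq
  have h1 : 1 ≤ Nat.card F := Nat.card_pos
  have ea := two_mul_ncard_torusTraces hq hn (Or.inl rfl)
  have eb := two_mul_ncard_torusTraces hq hn (Or.inr rfl)
  have hn0 : 0 < n := hn.pos
  have hd0 : 0 < d := hd ▸ Nat.gcd_pos_of_pos_right _ hn0
  have hd0' : 0 < d' := hd' ▸ Nat.gcd_pos_of_pos_right _ hn0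
  have ka := Nat.mul_div_cancel' (Nat.gcd_dvd_left (Nat.card F - 1) n)
  have kb := Nat.mul_div_cancel' (Nat.gcd_dvd_left (Nat.card F + 1) n)
  have fc := numPowerClasses_eq_of_natCast_ne_zero h2 hn
  have fs := numPowers_eq_of_natCast_ne_zero h2 hn
  have fc' := fun hp : n.Prime => numPowerClasses_eq_of_natCast_eq_zero h2 hp hn
  have fs' := fun hp : n.Prime => numPowers_eq_of_natCast_eq_zero h2 hp hn
  rw [← ea, hd] at ka
  rw [← eb, hd'] at kb
  rw [hd, hd'] at fc fs fc' fs'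
  generalize (torusTraces F ((Nat.card F - 1) / d)).ncard = α at *
  generalize (torusTraces F ((Nat.card F + 1) / d')).ncard = β at *
  generalize Nat.card F = q at *
  have hdR : (d : ℝ) ≠ 0 := by exact_mod_cast hd0.ne'
  have hdR' : (d' : ℝ) ≠ 0 := by exact_mod_cast hd0'.ne'
  have kaR : (d : ℝ) * (2 * α + 2) = q - 1 := by
    rw [eq_sub_iff_add_eq]
    have : d * (2 * α + 2) + 1 = q := by omega
    exact_mod_cast this
  have kbR : (d' : ℝ) * (2 * β + 2) = q + 1 := by exact_mod_cast kb
  have ia : ((q : ℝ) - 1) / (2 * d) = α + 1 := by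
    rw [← kaR]; field_simp
  have ib : ((q : ℝ) + 1) / (2 * d') = β + 1 := by
    rw [← kbR]; field_simp
  -- The `+ 1` in `α + 1` and `β + 1` contributes `q (q + 1) + q (q - 1) = 2 q ^ 2`, exactly the
  -- number of elements of trace `± 2`. This is why the formula has no correction term when `n` is
  -- invertible in `F`.
  have is : ((q : ℝ) ^ 3 - q) * (1 / (2 * d) + 1 / (2 * d')) =
      q * (q + 1) * (α + 1) + q * (q - 1) * (β + 1) := by
    rw [← ia, ← ib]; ring
  rw [ia, ib, is]
  constructor
  · intro h
    rw [fc h, fs h]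
    push_cast [Nat.cast_sub h1]
    constructor <;> ring
  · intro hp h
    rw [fc' hp h, fs' hp h]
    push_cast [Nat.cast_sub h1]
    constructor <;> ring

theorem natCard_SL2 (hq : Odd (Nat.card F)) :
    (Nat.card (SpecialLinearGroup (Fin 2) F) : ℝ) = (Nat.card F : ℝ) ^ 3 - Nat.card F := by
  rw [← numPowers_one, (((power_counts hq odd_one (Nat.gcd_one_right _)
    (Nat.gcd_one_right _)).1 (by simp)).2)]
  norm_num

theorem natCard_conjClasses_SL2 (hq : Odd (Nat.card F)) :
    (Nat.card (ConjClasses (SpecialLinearGroup (Fin 2) F)) : ℝ) = (Nat.card F : ℝ) + 4 := by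
  rw [← numPowerClasses_one, (((power_counts hq odd_one (Nat.gcd_one_right _)
    (Nat.gcd_one_right _)).1 (by simp)).1)]
  norm_num
  ring

theorem natCard_SL2_eq_mul (hq : Odd (Nat.card F)) :
    Nat.card (SpecialLinearGroup (Fin 2) F) =
      (Nat.card F - 1) * Nat.card F * (Nat.card F + 1) := by
  have h1 : 1 ≤ Nat.card F := Nat.card_pos
  have := natCard_SL2 hq
  have e : ((Nat.card (SpecialLinearGroup (Fin 2) F) : ℕ) : ℝ) =
      (((Nat.card F - 1) * Nat.card F * (Nat.card F + 1) : ℕ) : ℝ) := by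
    rw [this]
    push_cast [Nat.cast_sub h1]
    ring
  exact_mod_cast e

variable {n : ℕ}

theorem counts_of_not_dvd (hn : n.Prime) (hodd : Odd n) (hq : Odd (Nat.card F))
    (h : ¬ n ∣ Nat.card (SpecialLinearGroup (Fin 2) F)) :
    (numPowerClasses n F : ℝ) = (Nat.card F : ℝ) + 4 ∧
      (numPowers n F : ℝ) = (Nat.card F : ℝ) ^ 3 - Nat.card F := by
  rw [natCard_SL2_eq_mul hq, hn.dvd_mul, hn.dvd_mul] at h
  push Not at h
  obtain ⟨hc, hs⟩ := (power_counts hq hodd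
    ((Nat.coprime_comm.1 ((Nat.Prime.coprime_iff_not_dvd hn).2 h.1.1)).gcd_eq_one)
    ((Nat.coprime_comm.1 ((Nat.Prime.coprime_iff_not_dvd hn).2 h.2)).gcd_eq_one)).1
    (fun e => h.1.2 ((natCast_eq_zero_iff_dvd_card hn).1 e))
  rw [hc, hs]
  constructor <;> push_cast <;> ring

theorem not_dvd_of_dvd_card (hn : n.Prime) (h : n ∣ Nat.card F) :
    ¬ n ∣ Nat.card F - 1 ∧ ¬ n ∣ Nat.card F + 1 := by
  have h1 : 1 ≤ Nat.card F := Nat.card_pos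
  constructor
  · intro h'
    have := Nat.dvd_sub h h'
    rw [Nat.sub_sub_self h1] at this
    exact hn.one_lt.ne' (Nat.dvd_one.1 this)
  · intro h'
    exact hn.one_lt.ne' (Nat.dvd_one.1 ((Nat.dvd_add_right h).1 h'))

theorem counts_of_dvd_card (hn : n.Prime) (hodd : Odd n) (hq : Odd (Nat.card F))
    (h : n ∣ Nat.card F) :
    (numPowerClasses n F : ℝ) = (Nat.card F : ℝ) ∧
      (numPowers n F : ℝ) = ((Nat.card F : ℝ) - 2) * ((Nat.card F : ℝ) ^ 2 - 1) := by
  obtain ⟨ha, hb⟩ := not_dvd_of_dvd_card hn h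
  obtain ⟨hc, hs⟩ := (power_counts hq hodd
    ((Nat.coprime_comm.1 ((Nat.Prime.coprime_iff_not_dvd hn).2 ha)).gcd_eq_one)
    ((Nat.coprime_comm.1 ((Nat.Prime.coprime_iff_not_dvd hn).2 hb)).gcd_eq_one)).2 hn
    ((natCast_eq_zero_iff_dvd_card hn).2 h)
  rw [hc, hs]
  constructor <;> push_cast <;> ring

theorem not_dvd_add_one_of_dvd_sub_one (hn3 : 3 ≤ n) (h : n ∣ Nat.card F - 1) :
    ¬ n ∣ Nat.card F + 1 := by
  have h1 : 1 ≤ Nat.card F := Nat.card_pos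
  intro h'
  have := Nat.le_of_dvd two_pos ((Nat.dvd_add_right h).1
    (show n ∣ (Nat.card F - 1) + 2 by
      rwa [show Nat.card F - 1 + 2 = Nat.card F + 1 by omega]))
  omega

theorem counts_of_dvd_sub_one (hn : n.Prime) (hn3 : 3 ≤ n) (hq : Odd (Nat.card F))
    (h : n ∣ Nat.card F - 1) :
    (numPowerClasses n F : ℝ) = ((n : ℝ) + 1) * ((Nat.card F : ℝ) - 1) / (2 * (n : ℝ)) + 5 ∧
      (numPowers n F : ℝ) =
        ((n : ℝ) + 1) * ((Nat.card F : ℝ) ^ 3 - (Nat.card F : ℝ)) / (2 * (n : ℝ)) := by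
  have hb := not_dvd_add_one_of_dvd_sub_one hn3 h
  have hn0 : (n : ℝ) ≠ 0 := by exact_mod_cast hn.ne_zero
  obtain ⟨hc, hs⟩ := (power_counts hq (hn.odd_of_ne_two (by omega)) (Nat.gcd_eq_right h)
    ((Nat.coprime_comm.1 ((Nat.Prime.coprime_iff_not_dvd hn).2 hb)).gcd_eq_one)).1
    (fun e => (not_dvd_of_dvd_card hn ((natCast_eq_zero_iff_dvd_card hn).1 e)).1 h)
  rw [hc, hs]
  constructor <;> push_cast <;> field_simp <;> ring

theorem counts_of_dvd_add_one (hn : n.Prime) (hn3 : 3 ≤ n) (hq : Odd (Nat.card F))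
    (h : n ∣ Nat.card F + 1) :
    (numPowerClasses n F : ℝ) =
        (((n : ℝ) + 1) * ((Nat.card F : ℝ) - 3) + 4) / (2 * (n : ℝ)) + 5 ∧
      (numPowers n F : ℝ) =
        ((n : ℝ) + 1) * ((Nat.card F : ℝ) ^ 3 - (Nat.card F : ℝ)) / (2 * (n : ℝ)) := by
  have ha : ¬ n ∣ Nat.card F - 1 := fun h' => not_dvd_add_one_of_dvd_sub_one hn3 h' h
  have hn0 : (n : ℝ) ≠ 0 := by exact_mod_cast hn.ne_zero
  obtain ⟨hc, hs⟩ := (power_counts hq (hn.odd_of_ne_two (by omega))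
    ((Nat.coprime_comm.1 ((Nat.Prime.coprime_iff_not_dvd hn).2 ha)).gcd_eq_one)
    (Nat.gcd_eq_right h)).1
    (fun e => (not_dvd_of_dvd_card hn ((natCast_eq_zero_iff_dvd_card hn).1 e)).2 h)
  rw [hc, hs]
  constructor <;> push_cast <;> field_simp <;> ring

/-- Both proportions are within `5 / (q + 4)` of the limit. -/
theorem proportions_close (hn : n.Prime) (hn3 : 3 ≤ n) (hq : Odd (Nat.card F))
    (hnq : ¬ n ∣ Nat.card F) (h : n ∣ Nat.card (SpecialLinearGroup (Fin 2) F)) :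
    |(numPowerClasses n F : ℝ) / (Nat.card (ConjClasses (SpecialLinearGroup (Fin 2) F)) : ℝ)
        - ((n : ℝ) + 1) / (2 * (n : ℝ))| ≤ 5 / ((Nat.card F : ℝ) + 4) ∧
      (numPowers n F : ℝ) / (Nat.card (SpecialLinearGroup (Fin 2) F) : ℝ)
        = ((n : ℝ) + 1) / (2 * (n : ℝ)) := by
  have hn0 : (n : ℝ) ≠ 0 := by exact_mod_cast hn.ne_zero
  have hG : (Nat.card (SpecialLinearGroup (Fin 2) F) : ℝ) ≠ 0 := by
    exact_mod_cast Nat.card_pos.ne'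
  have hG' := natCard_SL2 hq
  have hC := natCard_conjClasses_SL2 hq
  have hqp : (0 : ℝ) < (Nat.card F : ℝ) + 4 := by positivity
  rw [natCard_SL2_eq_mul hq, hn.dvd_mul, hn.dvd_mul] at h
  have hr : (numPowers n F : ℝ) =
      ((n : ℝ) + 1) * ((Nat.card F : ℝ) ^ 3 - (Nat.card F : ℝ)) / (2 * (n : ℝ)) := by
    rcases h with (h | h) | h
    · exact (counts_of_dvd_sub_one hn hn3 hq h).2
    · exact absurd h hnq
    · exact (counts_of_dvd_add_one hn hn3 hq h).2
  -- Multiplied by the class number `q + 4`, the deviation of the class proportion is `5 / 2 (1 - 1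
  -- / n)` or `3 / 2 (1 - 1 / n)`, so the bound `5` is generous.
  have hinv : 0 < (n : ℝ)⁻¹ ∧ (n : ℝ)⁻¹ ≤ 1 / 3 :=
    ⟨by positivity, by rw [inv_le_comm₀ (by exact_mod_cast hn.pos) (by norm_num)]; norm_num; exact hn3⟩
  refine ⟨?_, ?_⟩
  · have key (c : ℝ) (hc : |c - (n + 1) / (2 * n) * (Nat.card F + 4)| ≤ 5) :
        |c / (Nat.card F + 4) - ((n : ℝ) + 1) / (2 * (n : ℝ))| ≤ 5 / ((Nat.card F : ℝ) + 4) := by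
      rw [div_sub' hqp.ne', abs_div, abs_of_pos hqp]
      gcongr
      rwa [mul_comm ((Nat.card F : ℝ) + 4)]
    rw [hC]
    apply key
    rcases h with (h | h) | h
    · rw [(counts_of_dvd_sub_one hn hn3 hq h).1]
      have : ((n : ℝ) + 1) * ((Nat.card F : ℝ) - 1) / (2 * (n : ℝ)) + 5
          - (n + 1) / (2 * n) * (Nat.card F + 4) = 5 / 2 - 5 / 2 * (n : ℝ)⁻¹ := by
        field_simp
        ring
      rw [this, abs_le]
      constructor <;> linarith [hinv.1, hinv.2]
    · exact absurd h hnq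
    · rw [(counts_of_dvd_add_one hn hn3 hq h).1]
      have : (((n : ℝ) + 1) * ((Nat.card F : ℝ) - 3) + 4) / (2 * (n : ℝ)) + 5
          - (n + 1) / (2 * n) * (Nat.card F + 4) = 3 / 2 - 3 / 2 * (n : ℝ)⁻¹ := by
        field_simp
        ring
      rw [this, abs_le]
      constructor <;> linarith [hinv.1, hinv.2]
  · rw [hr, div_eq_iff hG, hG']
    ring

end Formulas

theorem theorem8p4 (n : ℕ) (hn : n.Prime) (hn3 : 3 ≤ n) :
    -- the exact formulas, for every finite field `F` with an odd number `q` of elements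
    (∀ (F : Type u) [Field F] [Finite F] (q : ℕ), Nat.card F = q → Odd q →
      (Nat.card (Matrix.SpecialLinearGroup (Fin 2) F) : ℝ)
          = ((q : ℝ) - 1) * (q : ℝ) * ((q : ℝ) + 1) ∧
      (¬ n ∣ Nat.card (Matrix.SpecialLinearGroup (Fin 2) F) →
        (numPowerClasses n F : ℝ) = (q : ℝ) + 4 ∧
        (numPowers n F : ℝ) = (q : ℝ) ^ 3 - (q : ℝ)) ∧
      (n ∣ q →
        (numPowerClasses n F : ℝ) = (q : ℝ) ∧
        (numPowers n F : ℝ) = ((q : ℝ) - 2) * ((q : ℝ) ^ 2 - 1)) ∧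
      (n ∣ q - 1 →
        (numPowerClasses n F : ℝ)
          = ((n : ℝ) + 1) * ((q : ℝ) - 1) / (2 * (n : ℝ)) + 5 ∧
        (numPowers n F : ℝ)
          = ((n : ℝ) + 1) * ((q : ℝ) ^ 3 - (q : ℝ)) / (2 * (n : ℝ))) ∧
      (n ∣ q + 1 →
        (numPowerClasses n F : ℝ)
          = (((n : ℝ) + 1) * ((q : ℝ) - 3) + 4) / (2 * (n : ℝ)) + 5 ∧
        (numPowers n F : ℝ)
          = ((n : ℝ) + 1) * ((q : ℝ) ^ 3 - (q : ℝ)) / (2 * (n : ℝ)))) ∧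
    -- both proportions tend to `(n + 1) / (2 n)` as `q → ∞` with `n ∤ q`, `n ∣ |SL₂(F)|`
    (∀ ε : ℝ, 0 < ε → ∃ N : ℕ, ∀ (F : Type u) [Field F] [Finite F] (q : ℕ),
      Nat.card F = q → Odd q → ¬ n ∣ q →
      n ∣ Nat.card (Matrix.SpecialLinearGroup (Fin 2) F) → N ≤ q →
        |(numPowerClasses n F : ℝ)
            / (Nat.card (ConjClasses (Matrix.SpecialLinearGroup (Fin 2) F)) : ℝ)
          - ((n : ℝ) + 1) / (2 * (n : ℝ))| < ε ∧
        |(numPowers n F : ℝ) / (Nat.card (Matrix.SpecialLinearGroup (Fin 2) F) : ℝ)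
          - ((n : ℝ) + 1) / (2 * (n : ℝ))| < ε) := by
  refine ⟨?_, ?_⟩
  · rintro F _ _ q rfl hq
    refine ⟨?_, counts_of_not_dvd hn (hn.odd_of_ne_two (by omega)) hq,
      counts_of_dvd_card hn (hn.odd_of_ne_two (by omega)) hq,
      counts_of_dvd_sub_one hn hn3 hq, counts_of_dvd_add_one hn hn3 hq⟩
    rw [natCard_SL2 hq]
    ring
  · intro ε hε
    -- `q > 5 / ε` already gives `5 / (q + 4) < ε`; the proportion of elements equals its limit and
    -- imposes no condition.
    obtain ⟨N, hN⟩ := exists_nat_gt (5 / ε)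
    refine ⟨N, ?_⟩
    rintro F _ _ q rfl hq hnq h hNq
    obtain ⟨hc, hs⟩ := proportions_close hn hn3 hq hnq h
    refine ⟨lt_of_le_of_lt hc ?_, by rw [hs, sub_self, abs_zero]; exact hε⟩
    have hNq' : (N : ℝ) ≤ Nat.card F := by exact_mod_cast hNq
    rw [div_lt_iff₀ (by positivity)]
    rw [div_lt_iff₀ hε] at hN
    nlinarith
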